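/- **Formulae and provability.** Formulae of propositional linear logic without variables are generated by $0, 1, A\otimes B, A\oplus B, ?A$ (the positive ones) and $\top,\bot,A ⅋ B, A\,\&\,B, !A$ (the negative ones); $A^\bot$ is the De Morgan dual. $\mathrm{LL}_T$ is the usual one-sided sequent calculus of linear logic (identity, cut, exchange, $1$, $\bot$, $\top$, $⅋$, $\oplus$, $\&$, dereliction, weakening, contraction, promotion), with the tensor rule replaced by: from $\vdash\Gamma,?\Theta,A$ and $\vdash\Delta,?\Theta,B$ infer $\vdash\Gamma,\Delta,?\Theta,A\otimes B$. **Positions.** A position is a finite tree whose edges are directed and labelled by positive formulae, whose vertices have a sign $P$ (proponent) or $O$ (opponent), and in which one vertex holds the token. An edge $x\to y$ labelled by a negative formula $A$ stands for the edge $y\to x$ labelled $A^\bot$. Positions are considered up to isomorphism. **Moves.** Let $v$ be the vertex holding the token. - Along an edge $v'\to v$, the token may be passed to $v'$. - If the only edge at $v$ is $v\xrightarrow{1}v'$, then $v$ and this edge may be deleted, the token passing to $v'$. - An edge $v\xrightarrow{A\oplus B}v'$ may be relabelled $A$, or $B$, and an edge $v\xrightarrow{?A}v'$ may be relabelled $A$,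 the token passing to $v'$. - An edge $v\xrightarrow{?A}v'$ may be erased together with the whole subtree on the side of $v'$, the token staying at $v$. - Given an edge $v\xrightarrow{A\otimes B}v'$, divide the other subtrees attached to $v$ into three families $\Gamma,\Gamma',\Theta$, where those of $\Theta$ are attached by edges going out of $v$ labelled by formulae of the form $?C$. Replace $v$ by two vertices $v_1,v_2$ of the same sign, with edges $v_1\xrightarrow{A}v'$ and $v_2\xrightarrow{B}v'$; attach $\Gamma$ and a copy of $\Theta$ to $v_1$, $\Gamma'$ and another copy of $\Theta$ to $v_2$; the token passes to $v'$. **Strategies and validity.** A play from $U$ is a path of moves starting at $U$. A strategy on $U$ is a prefix-closed set of plays from $U$ that contains the empty play, is stable under isomorphism of plays (position by position), and contains every extension of its plays by one move made by an opponent. It is winning if, at the end of each of its plays that has no proper extension in it, the token is held by an opponent. A formula $A$ is *valid* if there is a tree $U$ with a chosen vertex, all of whose vertices are proponents, such that for every tree $V$ with a chosen vertex, all of whose vertices are opponents, there is a winning strategy on the tree obtained by adding to $U$ and $V$ an edge labelled $A$ from the chosen vertex of $U$ to that of $V$, wherever the token is placed initially. **Theorem.** 1. All plays are finite: there is no infinite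 sequence of moves. 2. For no formula $A$ are $A$ and $A^\bot$ both valid. 3. Every formula provable in $\mathrm{LL}_T$ is valid. -/

import Mathlib

namespace LLGame

/-- Propositional formulae of linear logic (units, no propositional variables).
`quest A` is `?A`, `bang A` is `!A`. -/
inductive Formula : Type
  | zero | one
  | tens (A B : Formula)
  | plus (A B : Formula)
  | quest (A : Formula)
  | top | bot
  | par (A B : Formula)
  | wth (A B : Formula)
  | bang (A : Formula)

namespace Formula

/-- De Morgan duality (linear negation). -/
def dual : Formula → Formula
  | zero => top
  | one => bot
  | tens A B => par (dual A) (dual B)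
  | plus A B => wth (dual A) (dual B)
  | quest A => bang (dual A)
  | top => zero
  | bot => one
  | par A B => tens (dual A) (dual B)
  | wth A B => plus (dual A) (dual B)
  | bang A => quest (dual A)

/-- The positive formulae are `0`, `1`, `A ⊗ B`, `A ⊕ B` and `?A`; the others are negative. -/
def IsPositive : Formula → Prop
  | zero | one | tens _ _ | plus _ _ | quest _ => True
  | top | bot | par _ _ | wth _ _ | bang _ => False

end Formula

open Formula

/-- Provability of one-sided sequents (lists of formulae) in the variant of linear logic in which
the tensor rule is allowed to share a context consisting of `?`-formulae. All the other rules are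
the usual ones of propositional linear logic, contraction and cut included. -/
inductive Provable : List Formula → Prop
  | ax (A : Formula) : Provable [A, dual A]
  | cut (A : Formula) (Γ Δ : List Formula) :
      Provable (A :: Γ) → Provable (dual A :: Δ) → Provable (Γ ++ Δ)
  | exchange (Γ Δ : List Formula) : Γ.Perm Δ → Provable Γ → Provable Δ
  | one : Provable [Formula.one]
  | bot (Γ : List Formula) : Provable Γ → Provable (Formula.bot :: Γ)
  | top (Γ : List Formula) : Provable (Formula.top :: Γ)
  | tens (A B : Formula) (Γ Δ Θ : List Formula) :
      Provable (A :: (Γ ++ Θ.map quest)) → Provable (B :: (Δ ++ Θ.map quest)) →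
      Provable (Formula.tens A B :: (Γ ++ Δ ++ Θ.map quest))
  | par (A B : Formula) (Γ : List Formula) :
      Provable (A :: B :: Γ) → Provable (Formula.par A B :: Γ)
  | plusLeft (A B : Formula) (Γ : List Formula) :
      Provable (A :: Γ) → Provable (plus A B :: Γ)
  | plusRight (A B : Formula) (Γ : List Formula) :
      Provable (B :: Γ) → Provable (plus A B :: Γ)
  | wth (A B : Formula) (Γ : List Formula) :
      Provable (A :: Γ) → Provable (B :: Γ) → Provable (Formula.wth A B :: Γ)
  | dereliction (A : Formula) (Γ : List Formula) :
      Provable (A :: Γ) → Provable (quest A :: Γ)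
  | weakening (A : Formula) (Γ : List Formula) :
      Provable Γ → Provable (quest A :: Γ)
  | contraction (A : Formula) (Γ : List Formula) :
      Provable (quest A :: quest A :: Γ) → Provable (quest A :: Γ)
  | promotion (A : Formula) (Γ : List Formula) :
      Provable (A :: Γ.map quest) → Provable (bang A :: Γ.map quest)

/-- The two teams: `P` (proponents) and `O` (opponents). -/
inductive Sign : Type
  | P | O

/-- Finite, punctured, directed, signed, normally labelled trees. A tree is presented from its
selected vertex, the one holding the token, which is the root of the term: `node s Γ` is the tree
whose selected vertex has sign `s`, and whose edges at that vertex are listed in `Γ`, each together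
with the subtree at its other end, presented from that end.

Edges are given by the formula seen from the parent: an entry `(A, t)` with `A` positive is an edge
directed from the vertex to the root of `t` and labelled `A`; an entry `(A, t)` with `A` negative is
an edge directed from the root of `t` to the vertex and labelled `dual A`. The same edge, seen from
the root of `t`, is the formula `dual A`. So the first components of `Γ` form the sequent of the
selected vertex. -/
inductive Pos : Type
  | node (s : Sign) (Γ : List (Formula × Pos)) : Pos

namespace Pos

/-- The sign of the vertex holding the token. -/
def sign : Pos → Sign
  | node s _ => s

/-- Isomorphism of positions (preserving token, signs, directions and labels): the edges at any
vertex may be listed in any order. -/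
inductive Iso : Pos → Pos → Prop
  | refl (t : Pos) : Iso t t
  | trans {t u v : Pos} : Iso t u → Iso u v → Iso t v
  | perm (s : Sign) {Γ Δ : List (Formula × Pos)} : Γ.Perm Δ → Iso (node s Γ) (node s Δ)
  | congr (s : Sign) (A : Formula) (Γ : List (Formula × Pos)) {t u : Pos} :
      Iso t u → Iso (node s ((A, t) :: Γ)) (node s ((A, u) :: Γ))

/-- All the vertices of the tree have sign `s`. -/
inductive AllSign (s : Sign) : Pos → Prop
  | node (Γ : List (Formula × Pos)) : (∀ x ∈ Γ, AllSign s x.2) → AllSign s (node s Γ)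

/-- `link U A V` is the tree obtained from the disjoint union of `U` and `V` by adding an edge
labelled `A` from the selected vertex of `U` to that of `V` (normalised if `A` is negative).
The token is held by the selected vertex of `U`. -/
def link : Pos → Formula → Pos → Pos
  | node s Γ, A, V => node s ((A, V) :: Γ)

/-- `Repuncture t u`: up to isomorphism, `u` is the same tree as `t`, the token being placed at
an arbitrary vertex. (One step moves the token across one edge, regardless of its direction.) -/
inductive Repuncture (t : Pos) : Pos → Prop
  | refl : Repuncture t t
  | iso {u v : Pos} : Repuncture t u → Iso u v → Repuncture t v
  | step (s s' : Sign) (A : Formula) (Γ Δ : List (Formula × Pos)) :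
      Repuncture t (node s ((A, node s' Δ) :: Γ)) → Repuncture t (node s' ((dual A, node s Γ) :: Δ))

/-- The moves of the naive game, up to isomorphism. In each of them the active vertex is the root
of the left-hand position; `s` is its sign and `s'` is the sign of the passive vertex. -/
inductive BasicMove : Pos → Pos → Prop
  /-- The token is passed along an input edge, labelled by the positive formula `A`. -/
  | neg (s s' : Sign) (A : Formula) (Γ Δ : List (Formula × Pos)) : A.IsPositive →
      BasicMove (node s ((dual A, node s' Δ) :: Γ)) (node s' ((A, node s Γ) :: Δ))
  /-- If its sole edge is an output `1`, the active vertex passes the token along it, and is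
  deleted together with the edge. -/
  | one (s s' : Sign) (Δ : List (Formula × Pos)) :
      BasicMove (node s [(Formula.one, node s' Δ)]) (node s' Δ)
  /-- The active vertex splits in two; the subtrees in `Θ`, all attached by outputs of the shape
  `?C`, are duplicated. -/
  | tens (s s' : Sign) (A B : Formula) (Γ Θ Γ' Δ : List (Formula × Pos)) :
      (∀ x ∈ Θ, ∃ C, x.1 = quest C) →
      BasicMove (node s ((Formula.tens A B, node s' Δ) :: (Γ ++ Θ ++ Γ')))
        (node s' ((dual A, node s (Γ ++ Θ)) :: (dual B, node s (Γ' ++ Θ)) :: Δ))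
  | plusLeft (s s' : Sign) (A B : Formula) (Γ Δ : List (Formula × Pos)) :
      BasicMove (node s ((plus A B, node s' Δ) :: Γ)) (node s' ((dual A, node s Γ) :: Δ))
  | plusRight (s s' : Sign) (A B : Formula) (Γ Δ : List (Formula × Pos)) :
      BasicMove (node s ((plus A B, node s' Δ) :: Γ)) (node s' ((dual B, node s Γ) :: Δ))
  | dereliction (s s' : Sign) (A : Formula) (Γ Δ : List (Formula × Pos)) :
      BasicMove (node s ((quest A, node s' Δ) :: Γ)) (node s' ((dual A, node s Γ) :: Δ))
  /-- An output `?A` is erased together with the whole subtree at its other end; the active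
  vertex keeps the token. -/
  | weakening (s : Sign) (A : Formula) (t : Pos) (Γ : List (Formula × Pos)) :
      BasicMove (node s ((quest A, t) :: Γ)) (node s Γ)

/-- The moves of the naive game, as a reduction relation on positions invariant under
isomorphism. -/
def Move (U V : Pos) : Prop :=
  ∃ U' V', Iso U U' ∧ BasicMove U' V' ∧ Iso V' V

end Pos

/-- `[U₁, …, Uₙ]` is a (finite) play from `U` if `U → U₁ → ⋯ → Uₙ` is a path in the graph of
positions and moves. The empty list is the empty play. -/
def IsPlay (U : Pos) (p : List Pos) : Prop :=
  List.IsChain Pos.Move (U :: p)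

/-- The final position of a play `p` from `U`. -/
def finalPos (U : Pos) (p : List Pos) : Pos :=
  (U :: p).getLast (List.cons_ne_nil U p)

/-- Strategies (for the proponents) on a position `U`. -/
structure IsStrategy (U : Pos) (S : Set (List Pos)) : Prop where
  plays : ∀ p ∈ S, IsPlay U p
  empty_mem : [] ∈ S
  prefix_closed : ∀ p q : List Pos, p <+: q → q ∈ S → p ∈ S
  /-- A strategy contains two isomorphic plays from `U` at the same time. -/
  iso_stable : ∀ p q : List Pos, p ∈ S → IsPlay U q → List.Forall₂ Pos.Iso p q → q ∈ S
  /-- Any move by an opponent is accepted. -/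
  welcoming : ∀ p ∈ S, (finalPos U p).sign = Sign.O →
    ∀ V, Pos.Move (finalPos U p) V → p ++ [V] ∈ S

/-- A strategy is winning if, at the end of each of its maximal plays, the token is held by an
opponent. -/
def IsWinning (U : Pos) (S : Set (List Pos)) : Prop :=
  ∀ p ∈ S, (∀ q ∈ S, p <+: q → q = p) → (finalPos U p).sign = Sign.O

/-- Game validity of a formula `A`: there is a tree `U` (of proponents) such that for all trees `V`
(of opponents), the proponents have a winning strategy on the tree obtained by linking `U` to `V`
by an edge labelled `A`, wherever the token is placed initially. -/
def Valid (A : Formula) : Prop :=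
  ∃ U : Pos, U.AllSign Sign.P ∧ ∀ V : Pos, V.AllSign Sign.O →
    ∀ W : Pos, (Pos.link U A V).Repuncture W → ∃ S : Set (List Pos), IsStrategy W S ∧ IsWinning W S

end LLGame

namespace LLGame

namespace Formula

/-! All three statements rest on realizability relative to a set `Q` of positions closed under
isomorphism. A tree realizes `A` when it lands in `Q` after any attachment for `A`: one edge `A`
leading to a realizer of the dual if `A` is positive, or, if `A` is negative, the edges that a move
on the dual formula can create at its receiver.

The engine is `mem_of_forall_realizes`. Suppose that a position whose active vertex has sign `s` is
in `Q` as soon as all its moves lead into `Q`. Then a vertex of sign `s` is in `Q` whenever each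
neighbour realizes the formula it sees. The induction is on the total size of the sequent at that
vertex: a move may duplicate subtrees, but it only shrinks the sequents of the vertices coming from
the active one.

Termination is the case where `Q` is accessibility: both signs satisfy the hypothesis, so every tree
realizes every formula. For soundness, `Q` is the set `Win` of positions won by the proponents.
Opponent vertices satisfy the hypothesis, and each rule of the calculus becomes a construction of
proponent realizers. The identity is a copycat; a cut on `A` becomes an internal edge `?(A ⊗ A⊥)`
between proponents, on which a copycat is played after the split. Contraction follows from cut and
the tensor with shared context.

Consistency uses only that `Win` captures winning strategies: proponent trees witnessing `A` and its
dual, played against each other with the teams exchanged on one side, would make both teams win the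
same position. -/

@[simp] theorem dual_dual (A : Formula) : A.dual.dual = A := by
  induction A <;> simp_all [dual]

/-- The number of connectives and units of a formula. -/
def size : Formula → ℕ
  | zero | one | top | bot => 1
  | tens A B | plus A B | par A B | wth A B => size A + size B + 1
  | quest A | bang A => size A + 1

theorem isPositive_or_dual (A : Formula) : A.IsPositive ∨ A.dual.IsPositive := by
  cases A <;> simp [IsPositive, dual]

end Formula

/-! ### Positions: attachments, width and invariance under isomorphism. -/

namespace Pos

open Formula

theorem induction_children {C : Pos → Prop}
    (h : ∀ s Γ, (∀ x ∈ Γ, C x.2) → C (node s Γ)) : ∀ t, C t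
  | node s Γ => h s Γ fun x _ => induction_children h x.2
termination_by t => sizeOf t
decreasing_by
  have := List.sizeOf_lt_of_mem ‹_›
  cases x
  simp at this ⊢
  omega

/-- The edges at the root. -/
def edges : Pos → List (Formula × Pos)
  | node _ Γ => Γ

/-- Adding edges at the root. -/
def attach (l : List (Formula × Pos)) : Pos → Pos
  | node s Γ => node s (l ++ Γ)

@[simp] theorem attach_node (l : List (Formula × Pos)) (s : Sign) (Γ : List (Formula × Pos)) :
    (node s Γ).attach l = node s (l ++ Γ) := rfl

/-- The total size of the sequent of the root. -/
def width (t : Pos) : ℕ := (t.edges.map fun x => x.1.size).sum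

theorem Iso.symm {t u : Pos} (h : Iso t u) : Iso u t := by
  induction h with
  | refl => exact .refl _
  | trans _ _ h₁ h₂ => exact h₂.trans h₁
  | perm s h => exact .perm s h.symm
  | congr s A Γ _ h => exact .congr s A Γ h

theorem Iso.attach {t u : Pos} (l : List (Formula × Pos)) (h : Iso t u) :
    Iso (t.attach l) (u.attach l) := by
  induction h with
  | refl => exact .refl _
  | trans _ _ h₁ h₂ => exact h₁.trans h₂
  | perm s h => exact .perm s (h.append_left l)
  | congr s A Γ h _ =>
    exact ((Iso.perm s List.perm_middle).trans (.congr s A _ h)).trans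
      (.perm s List.perm_middle.symm)

theorem Iso.sign_eq {t u : Pos} (h : Iso t u) : t.sign = u.sign := by
  induction h with
  | refl => rfl
  | trans _ _ h₁ h₂ => exact h₁.trans h₂
  | perm => rfl
  | congr => rfl

theorem Iso.width_eq {t u : Pos} (h : Iso t u) : t.width = u.width := by
  induction h with
  | refl => rfl
  | trans _ _ h₁ h₂ => exact h₁.trans h₂
  | perm s h => exact (h.map _).sum_eq
  | congr => simp [width, edges]

theorem Iso.forall_edges {R : Formula → Pos → Prop} (hR : ∀ A t u, Iso t u → R A t → R A u)
    {t u : Pos} (h : Iso t u) (ht : ∀ x ∈ t.edges, R x.1 x.2) : ∀ x ∈ u.edges, R x.1 x.2 := by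
  induction h with
  | refl => exact ht
  | trans _ _ h₁ h₂ => exact h₂ (h₁ ht)
  | perm s h => exact fun x hx => ht x (h.mem_iff.2 hx)
  | congr s A Γ h =>
    simp only [edges, List.forall_mem_cons] at ht ⊢
    exact ⟨hR _ _ _ h ht.1, ht.2⟩

theorem BasicMove.move {U V : Pos} (h : BasicMove U V) : Move U V :=
  ⟨U, V, .refl _, h, .refl _⟩

theorem Move.of_iso_left {U U' V : Pos} (h : Iso U U') : Move U' V → Move U V
  | ⟨X, Y, h₁, h₂, h₃⟩ => ⟨X, Y, h.trans h₁, h₂, h₃⟩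

end Pos

open Formula Pos

/-! ### Realizability with respect to a set of positions -/

section Realizability

variable (Q : Pos → Prop)

/-- The trees on which all the attachments in `a` yield a position in `Q`. -/
def Test (a : List (Formula × Pos) → Prop) (t : Pos) : Prop :=
  ∀ l, a l → Q (t.attach l)

/-- The one-edge attachments labelled `A` and leading to a tree that passes the tests in `a`. -/
def Single (A : Formula) (a : List (Formula × Pos) → Prop) (l : List (Formula × Pos)) : Prop :=
  ∃ t, l = [(A, t)] ∧ Test Q a t

/-- The two-edge attachments leading to trees that pass given tests. -/
def Double (A B : Formula) (a b : List (Formula × Pos) → Prop) (l : List (Formula × Pos)) : Prop :=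
  ∃ t u, l = [(A, t), (B, u)] ∧ Test Q a t ∧ Test Q b u

/-- The attachments that replace a formula, and those that replace its dual. -/
def attachments :
    Formula → (List (Formula × Pos) → Prop) × (List (Formula × Pos) → Prop)
  | zero => (Single Q zero fun _ => False, fun _ => False)
  | top => (fun _ => False, Single Q zero fun _ => False)
  | one => (Single Q one fun l => l = [], fun l => l = [])
  | bot => (fun l => l = [], Single Q one fun l => l = [])
  | tens A B =>
    (Single Q (tens A B) (Double Q A.dual B.dual (attachments A).1 (attachments B).1),
      Double Q A.dual B.dual (attachments A).1 (attachments B).1)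
  | par A B =>
    (Double Q A B (attachments A).2 (attachments B).2,
      Single Q (tens A.dual B.dual) (Double Q A B (attachments A).2 (attachments B).2))
  | plus A B =>
    (Single Q (plus A B) fun l =>
        Single Q A.dual (attachments A).1 l ∨ Single Q B.dual (attachments B).1 l,
      fun l => Single Q A.dual (attachments A).1 l ∨ Single Q B.dual (attachments B).1 l)
  | wth A B =>
    (fun l => Single Q A (attachments A).2 l ∨ Single Q B (attachments B).2 l,
      Single Q (plus A.dual B.dual) fun l =>
        Single Q A (attachments A).2 l ∨ Single Q B (attachments B).2 l)
  | quest A =>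
    (Single Q (quest A) (Single Q A.dual (attachments A).1), Single Q A.dual (attachments A).1)
  | bang A =>
    (Single Q A (attachments A).2, Single Q (quest A.dual) (Single Q A (attachments A).2))

/-- `A.dual` is not a subformula of `A`, so the structural recursion computes both sides at once;
this symmetry then lets `Att` alone carry the theory. -/
theorem attachments_dual (A : Formula) : attachments Q A.dual = (attachments Q A).swap := by
  induction A <;> simp_all [dual, attachments]

/-- The attachments that may replace the formula `A` in the sequent of a vertex: an edge labelled
`A` to a realizer of the dual if `A` is positive, and its immediate components if `A` is
negative. -/
def Att (A : Formula) : List (Formula × Pos) → Prop := (attachments Q A).1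

/-- The trees that realize the formula `A`. -/
def Realizes (A : Formula) : Pos → Prop := Test Q (Att Q A)

theorem attachments_snd (A : Formula) : (attachments Q A).2 = Att Q A.dual := by
  rw [Att, attachments_dual]; rfl

variable {Q}

theorem att_of_isPositive {A : Formula} (hA : A.IsPositive) (l : List (Formula × Pos)) :
    Att Q A l ↔ ∃ t, l = [(A, t)] ∧ Realizes Q A.dual t := by
  have h : Att Q A = Single Q A (Att Q A.dual) := by
    rw [← attachments_snd]
    cases A <;> first | rfl | exact hA.elim
  rw [h]; rfl

theorem att_one (l : List (Formula × Pos)) : Att Q one l ↔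
    ∃ t, l = [(one, t)] ∧ Realizes Q bot t :=
  att_of_isPositive (A := Formula.one) trivial l

theorem att_tens (A B : Formula) (l : List (Formula × Pos)) : Att Q (tens A B) l ↔
    ∃ t, l = [(tens A B, t)] ∧ Realizes Q (par A.dual B.dual) t :=
  att_of_isPositive (A := tens A B) trivial l

theorem att_plus (A B : Formula) (l : List (Formula × Pos)) : Att Q (plus A B) l ↔
    ∃ t, l = [(plus A B, t)] ∧ Realizes Q (wth A.dual B.dual) t :=
  att_of_isPositive (A := plus A B) trivial l

theorem att_quest (A : Formula) (l : List (Formula × Pos)) : Att Q (quest A) l ↔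
    ∃ t, l = [(quest A, t)] ∧ Realizes Q (bang A.dual) t :=
  att_of_isPositive (A := quest A) trivial l

@[simp] theorem att_bot (l : List (Formula × Pos)) : Att Q bot l ↔ l = [] := Iff.rfl

theorem att_par (A B : Formula) (l : List (Formula × Pos)) : Att Q (par A B) l ↔
    ∃ t u, l = [(A, t), (B, u)] ∧ Realizes Q A.dual t ∧ Realizes Q B.dual u := by
  have h : Att Q (par A B) = Double Q A B (Att Q A.dual) (Att Q B.dual) := by
    rw [← attachments_snd, ← attachments_snd]; rfl
  rw [h]; rfl

theorem att_wth (A B : Formula) (l : List (Formula × Pos)) : Att Q (wth A B) l ↔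
    (∃ t, l = [(A, t)] ∧ Realizes Q A.dual t) ∨ ∃ t, l = [(B, t)] ∧ Realizes Q B.dual t := by
  have h : Att Q (wth A B) =
      fun l => Single Q A (Att Q A.dual) l ∨ Single Q B (Att Q B.dual) l := by
    rw [← attachments_snd, ← attachments_snd]; rfl
  rw [h]; rfl

theorem att_bang (A : Formula) (l : List (Formula × Pos)) : Att Q (bang A) l ↔
    ∃ t, l = [(A, t)] ∧ Realizes Q A.dual t := by
  have h : Att Q (bang A) = Single Q A (Att Q A.dual) := by
    rw [← attachments_snd]; rfl
  rw [h]; rfl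

/-- Independent of polarity: attachments preserve the invariant that every neighbour of a vertex
realizes the formula seen from its own end. -/
theorem Att.realizes {A : Formula} {l : List (Formula × Pos)} (h : Att Q A l) :
    ∀ x ∈ l, Realizes Q x.1.dual x.2 := by
  by_cases hA : A.IsPositive
  · obtain ⟨t, rfl, ht⟩ := (att_of_isPositive hA l).1 h
    simpa using ht
  · cases A with
    | top => exact h.elim
    | bot => simp_all
    | par A B => obtain ⟨t, u, rfl, ht, hu⟩ := (att_par A B l).1 h; simpa using ⟨ht, hu⟩
    | wth A B => obtain ⟨t, rfl, ht⟩ | ⟨t, rfl, ht⟩ := (att_wth A B l).1 h <;> simpa using ht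
    | bang A => obtain ⟨t, rfl, ht⟩ := (att_bang A l).1 h; simpa using ht
    | _ => exact (hA trivial).elim

/-- A negative formula is replaced by its components and so loses a symbol. This strict decrease
handles the passing of the token along an input edge. -/
theorem Att.size_lt {A : Formula} (hA : A.dual.IsPositive) {l : List (Formula × Pos)}
    (h : Att Q A l) : (l.map fun x => x.1.size).sum < A.size := by
  cases A with
  | top => exact h.elim
  | bot => rw [att_bot] at h; simp [h, size]
  | par A B => obtain ⟨t, u, rfl, -⟩ := (att_par A B l).1 h; simp [size]
  | wth A B => obtain ⟨t, rfl, -⟩ | ⟨t, rfl, -⟩ := (att_wth A B l).1 h <;> simp [size]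
  | bang A => obtain ⟨t, rfl, -⟩ := (att_bang A l).1 h; simp [size]
  | _ => exact hA.elim

theorem Att.size_le {A : Formula} {l : List (Formula × Pos)}
    (h : Att Q A l) : (l.map fun x => x.1.size).sum ≤ A.size := by
  obtain hA | hA := A.isPositive_or_dual
  · obtain ⟨t, rfl, -⟩ := (att_of_isPositive hA l).1 h
    simp
  · exact (Att.size_lt hA h).le

theorem Realizes.of_iso (hQ : ∀ t u, Iso t u → Q t → Q u) {A : Formula} {t u : Pos}
    (h : Iso t u) (ht : Realizes Q A t) : Realizes Q A u :=
  fun l hl => hQ _ _ (h.attach l) (ht l hl)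

/-- Interaction of a realizer of a positive formula with a vertex realizing its dual. -/
theorem Realizes.interact {A : Formula} (hA : A.IsPositive) {t u : Pos} (ht : Realizes Q A t)
    (hu : Realizes Q A.dual u) : Q (t.attach [(A, u)]) :=
  ht _ ((att_of_isPositive hA _).2 ⟨u, rfl, hu⟩)

/-- If `Q` contains the positions of sign `s` all of whose moves lead to `Q`, then any vertex of
sign `s` whose neighbours are realizers is in `Q`. -/
theorem mem_of_forall_realizes (hQ : ∀ t u, Iso t u → Q t → Q u) {s : Sign}
    (hs : ∀ U : Pos, U.sign = s → (∀ V, Move U V → Q V) → Q U) :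
    ∀ (n : ℕ) (t : Pos), t.width = n → t.sign = s →
      (∀ x ∈ t.edges, Realizes Q x.1.dual x.2) → Q t := by
  intro n
  induction n using Nat.strong_induction_on with
  | _ n ih =>
  intro t hn ht h
  refine hs t ht ?_
  rintro V ⟨U', V', hU, hm, hV⟩
  refine hQ _ _ hV ?_
  have hw := hU.width_eq.symm.trans hn
  have hsg := hU.sign_eq.symm.trans ht
  replace h := hU.forall_edges (R := fun A t => Realizes Q A.dual t)
    (fun A t u hi => Realizes.of_iso hQ hi) h
  -- What remains of the active vertex after a move realizes the new formula on its edge: any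
  -- attachment for `A` gives a sequent smaller than the original.
  have key : ∀ (A : Formula) (Γ : List (Formula × Pos)),
      (Γ.map fun x => x.1.size).sum + A.size < n →
      (∀ x ∈ Γ, Realizes Q x.1.dual x.2) → Realizes Q A (.node s Γ) := by
    intro A Γ hlt hΓ l hl
    refine ih _ ?_ _ rfl rfl ?_
    · have := hl.size_le
      simp only [width, edges, attach, List.map_append, List.sum_append]
      omega
    · simp only [edges, attach, List.mem_append]
      rintro x (hx | hx)
      exacts [hl.realizes x hx, hΓ x hx]
  cases hm with
  | neg s₁ s' A Γ Δ hA =>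
    obtain rfl : s₁ = s := hsg
    simp only [edges, List.forall_mem_cons, dual_dual] at h
    -- The neighbour realizes the positive formula `A`, so it suffices that the rest of the active
    -- vertex realizes the negative dual.
    refine h.1.interact hA (u := .node s₁ Γ) ?_
    intro l hl
    refine ih _ ?_ _ rfl rfl ?_
    · have := hl.size_lt (by simpa using hA)
      simp only [width, edges, attach, List.map_cons, List.sum_cons, List.map_append,
        List.sum_append] at hw ⊢
      omega
    · simp only [edges, attach, List.mem_append]
      rintro x (hx | hx)
      exacts [hl.realizes x hx, h.2 x hx]
  | one s₁ s' Δ =>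
    simp only [edges, List.forall_mem_cons] at h
    exact h.1 [] rfl
  | tens s₁ s' A B Γ Θ Γ' Δ hΘ =>
    obtain rfl : s₁ = s := hsg
    simp only [edges, List.forall_mem_cons] at h
    simp only [width, edges, List.map_cons, List.sum_cons, List.map_append,
        List.sum_append, size] at hw
    refine h.1 [(A.dual, _), (B.dual, _)] ((att_par _ _ _).2 ⟨_, _, rfl, ?_, ?_⟩)
    · rw [dual_dual]
      refine key _ _ ?_ ?_
      · simp only [List.map_append, List.sum_append]; omega
      · intro x hx; apply h.2; simp_all; tauto
    · rw [dual_dual]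
      refine key _ _ ?_ ?_
      · simp only [List.map_append, List.sum_append]; omega
      · intro x hx; apply h.2; simp_all; tauto
  | plusLeft s₁ s' A B Γ Δ =>
    obtain rfl : s₁ = s := hsg
    simp only [edges, List.forall_mem_cons] at h
    simp only [width, edges, List.map_cons, List.sum_cons, size] at hw
    refine h.1 [(A.dual, _)] ((att_wth _ _ _).2 (.inl ⟨_, rfl, ?_⟩))
    rw [dual_dual]
    exact key _ _ (by omega) h.2
  | plusRight s₁ s' A B Γ Δ =>
    obtain rfl : s₁ = s := hsg
    simp only [edges, List.forall_mem_cons] at h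
    simp only [width, edges, List.map_cons, List.sum_cons, size] at hw
    refine h.1 [(B.dual, _)] ((att_wth _ _ _).2 (.inr ⟨_, rfl, ?_⟩))
    rw [dual_dual]
    exact key _ _ (by omega) h.2
  | dereliction s₁ s' A Γ Δ =>
    obtain rfl : s₁ = s := hsg
    simp only [edges, List.forall_mem_cons] at h
    simp only [width, edges, List.map_cons, List.sum_cons, size] at hw
    refine h.1 [(A.dual, _)] ((att_bang _ _).2 ⟨_, rfl, ?_⟩)
    rw [dual_dual]
    exact key _ _ (by omega) h.2
  | weakening s₁ A t Γ =>
    simp only [edges, List.forall_mem_cons] at h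
    simp only [width, edges, List.map_cons, List.sum_cons, size] at hw
    -- The token stays at the same vertex, so no realizer is invoked: only the width drops.
    refine ih _ ?_ _ rfl hsg h.2
    simp only [width, edges]
    omega

theorem realizes_of_forall_realizes (hQ : ∀ t u, Iso t u → Q t → Q u) {s : Sign}
    (hs : ∀ U : Pos, U.sign = s → (∀ V, Move U V → Q V) → Q U) (A : Formula)
    {Γ : List (Formula × Pos)} (hΓ : ∀ x ∈ Γ, Realizes Q x.1.dual x.2) :
    Realizes Q A (.node s Γ) := by
  intro l hl
  refine mem_of_forall_realizes hQ hs _ _ rfl rfl ?_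
  simp only [edges, attach, List.mem_append]
  rintro x (hx | hx)
  exacts [hl.realizes x hx, hΓ x hx]

end Realizability

/-! ### Termination -/

theorem acc_move (t : Pos) : Acc (flip Move) t := by
  have hQ : ∀ t u, Iso t u → Acc (flip Move) t → Acc (flip Move) u :=
    fun t u h ht => .intro _ fun V hV => ht.inv (Move.of_iso_left h hV)
  have hr : ∀ (t : Pos) A, Realizes (Acc (flip Move)) A t := by
    refine induction_children ?_
    intro s Γ h A
    exact realizes_of_forall_realizes hQ (fun U _ hU => .intro _ hU) A fun x hx => h x hx _
  cases t with
  -- The only attachment for `bot` is empty, so realizing `bot` is membership in `Q`.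
  | node s Γ => exact hr (.node s Γ) bot [] rfl

/-! ### Winning positions -/

/-- The positions won by the proponents. -/
inductive Win : Pos → Prop
  | opponent (U : Pos) : U.sign = .O → (∀ V, Move U V → Win V) → Win U
  | proponent (U V : Pos) : U.sign = .P → Move U V → Win V → Win U

theorem Win.of_iso {t u : Pos} (h : Iso t u) (ht : Win t) : Win u := by
  cases ht with
  | opponent _ hs hm =>
    exact .opponent _ (h.sign_eq ▸ hs) fun V hV => hm V (hV.of_iso_left h)
  | proponent _ V hs hm hV => exact .proponent _ V (h.sign_eq ▸ hs) (hm.of_iso_left h.symm) hV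

theorem Win.of_perm {s : Sign} {Γ Δ : List (Formula × Pos)} (h : Γ.Perm Δ)
    (ht : Win (.node s Γ)) : Win (.node s Δ) :=
  ht.of_iso (.perm s h)

theorem Win.of_basicMove {Γ : List (Formula × Pos)} {V : Pos} (h : BasicMove (.node .P Γ) V)
    (hV : Win V) : Win (.node .P Γ) :=
  .proponent _ V rfl h.move hV

/-! ### Winning strategies and the inductive set `Win`. -/

theorem isPlay_append_singleton {U V : Pos} {p : List Pos} (hp : IsPlay U p)
    (h : Move (finalPos U p) V) : IsPlay U (p ++ [V]) := by
  unfold IsPlay at *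
  rw [← List.cons_append, List.isChain_append]
  refine ⟨hp, List.isChain_singleton _, ?_⟩
  intro x hx y hy
  rw [List.getLast?_eq_some_getLast (List.cons_ne_nil U p)] at hx
  simp only [Option.mem_def, Option.some.injEq, List.head?_cons] at hx hy
  subst hx hy
  exact h

theorem move_of_isPlay_append {U V : Pos} {p q : List Pos} (hp : IsPlay U (p ++ V :: q)) :
    Move (finalPos U p) V := by
  unfold IsPlay at hp
  rw [← List.cons_append, List.isChain_append] at hp
  exact hp.2.2 _ (List.getLast?_eq_some_getLast _) _ rfl

theorem finalPos_append_singleton (U V : Pos) (p : List Pos) : finalPos U (p ++ [V]) = V := by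
  simp [finalPos]

theorem win_of_isWinning {U : Pos} {S : Set (List Pos)} (hS : IsStrategy U S)
    (hw : IsWinning U S) : Win U := by
  -- Induction on the final position, well-founded by termination of the game.
  suffices h : ∀ t, ∀ p ∈ S, finalPos U p = t → Win t from h U [] hS.empty_mem rfl
  intro t
  induction acc_move t with
  | intro t _ ih =>
  rintro p hp rfl
  cases hs : (finalPos U p).sign with
  | O =>
    exact .opponent _ hs fun V hV =>
      ih V hV _ (hS.welcoming p hp hs V hV) (finalPos_append_singleton _ _ _)
  | P =>
    have h : ¬ ∀ q ∈ S, p <+: q → q = p := fun h => by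
      have := hw p hp h
      rw [hs] at this
      cases this
    push Not at h
    obtain ⟨q, hq, ⟨r, rfl⟩, hne⟩ := h
    cases r with
    | nil => simp at hne
    | cons V r =>
      have hm := move_of_isPlay_append (hS.plays _ hq)
      refine .proponent _ V hs hm (ih V hm (p ++ [V]) ?_ (finalPos_append_singleton _ _ _))
      exact hS.prefix_closed _ _ ⟨r, by simp⟩ hq

theorem Win.exists_isWinning {U : Pos} (hU : Win U) :
    ∃ S : Set (List Pos), IsStrategy U S ∧ IsWinning U S := by
  have hfin : ∀ p : List Pos, (∀ V ∈ p, Win V) → Win (finalPos U p) := by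
    intro p hp
    have : finalPos U p ∈ U :: p := List.getLast_mem _
    rcases List.mem_cons.1 this with h | h
    · rwa [h]
    · exact hp _ h
  -- The strategy consists of all plays that never leave `Win`.
  refine ⟨{p | IsPlay U p ∧ ∀ V ∈ p, Win V}, ⟨fun p hp => hp.1, ?_, ?_, ?_, ?_⟩, ?_⟩
  · exact ⟨List.isChain_singleton _, by simp⟩
  · rintro p _ ⟨r, rfl⟩ ⟨h₁, h₂⟩
    refine ⟨?_, fun V hV => h₂ V (List.mem_append_left _ hV)⟩
    exact List.IsChain.left_of_append (l₂ := r) h₁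
  · rintro p q ⟨-, h⟩ hq hpq
    refine ⟨hq, ?_⟩
    clear hq
    induction hpq with
    | nil => simp
    | cons h₁ _ ih =>
      rw [List.forall_mem_cons] at h ⊢
      exact ⟨h.1.of_iso h₁, ih h.2⟩
  · rintro p ⟨h₁, h₂⟩ hs V hV
    refine ⟨isPlay_append_singleton h₁ hV, ?_⟩
    have hV' : Win V := by
      cases hfin p h₂ with
      | opponent _ _ h => exact h V hV
      | proponent _ _ h => rw [hs] at h; cases h
    intro W hW
    rcases List.mem_append.1 hW with hW | hW
    · exact h₂ W hW
    · rwa [List.mem_singleton.1 hW]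
  · rintro p ⟨h₁, h₂⟩ hmax
    cases hfin p h₂ with
    | opponent _ h => exact h
    | proponent _ V _ hm hV =>
      have := hmax (p ++ [V]) ⟨isPlay_append_singleton h₁ hm, ?_⟩ ⟨[V], rfl⟩
      · simp at this
      · intro W hW
        rcases List.mem_append.1 hW with hW | hW
        · exact h₂ W hW
        · rwa [List.mem_singleton.1 hW]

/-! ### Consistency -/

/-- Exchange of the two teams. -/
def Sign.swap : Sign → Sign
  | P => O
  | O => P

/-- Exchange of the two teams in a position. -/
def Pos.swap : Pos → Pos
  | node s Γ => node s.swap (Γ.map fun x => (x.1, x.2.swap))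
termination_by t => sizeOf t
decreasing_by
  have := List.sizeOf_lt_of_mem ‹_›
  cases x
  simp at this ⊢
  omega

theorem Pos.swap_node (s : Sign) (Γ : List (Formula × Pos)) :
    (node s Γ).swap = node s.swap (Γ.map fun x => (x.1, x.2.swap)) := by
  rw [Pos.swap]

theorem Pos.swap_swap (t : Pos) : t.swap.swap = t := by
  induction t using induction_children with
  | h s Γ ih =>
    have hs : s.swap.swap = s := by cases s <;> rfl
    rw [swap_node, swap_node, hs, List.map_map, List.map_congr_left (g := id), List.map_id]
    intro x hx
    simp [ih x hx]

theorem Pos.sign_swap (t : Pos) : t.swap.sign = t.sign.swap := by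
  cases t; rw [swap_node]; rfl

theorem Pos.Iso.swap {t u : Pos} (h : Iso t u) : Iso t.swap u.swap := by
  induction h with
  | refl => exact .refl _
  | trans _ _ h₁ h₂ => exact h₁.trans h₂
  | perm s h => rw [swap_node, swap_node]; exact .perm _ (h.map _)
  | congr s A Γ _ h => rw [swap_node, swap_node]; exact .congr _ A _ h

theorem Pos.BasicMove.swap {t u : Pos} (h : BasicMove t u) : BasicMove t.swap u.swap := by
  cases h with
  | tens s s' A B Γ Θ Γ' Δ hΘ =>
    simp only [swap_node, List.map_cons, List.map_append]
    refine .tens _ _ A B _ _ _ _ fun x hx => ?_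
    obtain ⟨y, hy, rfl⟩ := List.mem_map.1 hx
    exact hΘ y hy
  | neg s s' A Γ Δ hA => simp only [swap_node, List.map_cons]; exact .neg _ _ A _ _ hA
  | _ => simp only [swap_node, List.map_cons, List.map_nil]; constructor

theorem Pos.Move.swap {t u : Pos} : Move t u → Move t.swap u.swap
  | ⟨_, _, h₁, h₂, h₃⟩ => ⟨_, _, h₁.swap, h₂.swap, h₃.swap⟩

theorem Win.not_win_swap {t : Pos} (h : Win t) : ¬ Win t.swap := by
  induction h with
  | opponent U hs _ ih =>
    intro h
    have hs' : U.swap.sign = .P := by rw [sign_swap, hs]; rfl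
    cases h with
    | opponent _ h => rw [hs'] at h; cases h
    | proponent _ V _ hm hV =>
      have := hm.swap
      rw [swap_swap] at this
      exact ih _ this (by rwa [swap_swap])
  | proponent U V hs hm _ ih =>
    intro h
    have hs' : U.swap.sign = .O := by rw [sign_swap, hs]; rfl
    cases h with
    | opponent _ _ h => exact ih (h _ hm.swap)
    | proponent _ _ h => rw [hs'] at h; cases h

theorem Pos.AllSign.swap {t : Pos} : t.AllSign .P → t.swap.AllSign .O := by
  induction t using induction_children with
  | h s Γ ih =>
    rintro ⟨_, h⟩
    rw [swap_node]
    refine .node _ fun x hx => ?_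
    obtain ⟨y, hy, rfl⟩ := List.mem_map.1 hx
    exact ih y hy (h y hy)

theorem Valid.not_dual {A : Formula} : Valid A → ¬ Valid A.dual := by
  rintro ⟨U, hU, hUA⟩ ⟨V, hV, hVA⟩
  obtain ⟨S, hS, hw⟩ := hUA _ hV.swap _ .refl
  have h₁ := win_of_isWinning hS hw
  cases U with
  | node s Γ =>
  cases V with
  | node s' Δ =>
  -- The token is moved across the linking edge, which makes this position exactly the swap of the
  -- first one.
  obtain ⟨T, hT, hw⟩ := hVA _ hU.swap (.node s.swap ((A, .node s' Δ) ::
      Γ.map fun x => (x.1, x.2.swap))) (by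
    have := Repuncture.step (t := link (.node s' Δ) A.dual (Pos.node s Γ).swap) s' s.swap A.dual Δ
      (Γ.map fun x => (x.1, x.2.swap)) (by rw [swap_node]; exact .refl)
    rwa [dual_dual] at this)
  have h₂ := win_of_isWinning hT hw
  refine h₁.not_win_swap ?_
  rwa [link, swap_node, List.map_cons, swap_swap]

/-! ### Copycat -/

/-- If `A` is negative, the proponent passes the token to `u`, which then interacts with the rest as
a realizer of the positive dual. -/
theorem Win.cons_of_realizes {A : Formula} {u : Pos} {Γ : List (Formula × Pos)}
    (h : Realizes Win A (.node .P Γ)) (hu : Realizes Win A.dual u) :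
    Win (.node .P ((A, u) :: Γ)) := by
  obtain hA | hA := A.isPositive_or_dual
  · exact h.interact hA hu
  · cases u with
    | node s Δ =>
    have hm := BasicMove.neg .P s A.dual Γ Δ hA
    rw [dual_dual] at hm
    exact Win.of_basicMove hm (hu.interact hA (by rwa [dual_dual]))

/-- A proponent with two dual edges wins. -/
def Copycat (A : Formula) : Prop :=
  ∀ a b, Att Win A a → Att Win A.dual b → Win (.node .P (a ++ b))

theorem Copycat.dual {A : Formula} (h : Copycat A) : Copycat A.dual := by
  intro a b ha hb
  rw [dual_dual] at hb
  exact (h b a hb ha).of_perm List.perm_append_comm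

/-- A proponent relay in front of a realizer is again a realizer; this is what each half of a split
vertex becomes in the inductive steps. -/
theorem Copycat.realizes {A : Formula} (h : Copycat A) {u : Pos} (hu : Realizes Win A u) :
    Realizes Win A (.node .P [(A.dual, u)]) := by
  intro a ha
  refine Win.of_perm (List.perm_append_singleton _ a).symm (Win.cons_of_realizes ?_ ?_)
  · intro b hb
    exact (h a b ha hb).of_perm List.perm_append_comm
  · rwa [dual_dual]

theorem Copycat.zero : Copycat zero := fun _ _ _ hb => hb.elim

theorem Copycat.one : Copycat one := by
  intro a b ha hb
  obtain ⟨⟨s, Δ⟩, rfl, ht⟩ := (att_one a).1 ha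
  obtain rfl : b = [] := hb
  exact Win.of_basicMove (.one .P s Δ) (ht [] rfl)

theorem Copycat.tens {A B : Formula} (hA : Copycat A) (hB : Copycat B) : Copycat (tens A B) := by
  intro a b ha hb
  obtain ⟨⟨s, Δ⟩, rfl, ht⟩ := (att_tens _ _ a).1 ha
  obtain ⟨u, v, rfl, hu, hv⟩ := (att_par _ _ b).1 hb
  rw [dual_dual] at hu hv
  refine Win.of_basicMove (.tens .P s A B [(A.dual, u)] [] [(B.dual, v)] Δ (by simp)) ?_
  refine ht [(A.dual, _), (B.dual, _)] ((att_par _ _ _).2 ⟨_, _, rfl, ?_, ?_⟩)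
  · rw [dual_dual]; exact hA.realizes hu
  · rw [dual_dual]; exact hB.realizes hv

theorem Copycat.plus {A B : Formula} (hA : Copycat A) (hB : Copycat B) : Copycat (plus A B) := by
  intro a b ha hb
  obtain ⟨⟨s, Δ⟩, rfl, ht⟩ := (att_plus _ _ a).1 ha
  obtain ⟨u, rfl, hu⟩ | ⟨u, rfl, hu⟩ := (att_wth _ _ b).1 hb
  · rw [dual_dual] at hu
    refine Win.of_basicMove (.plusLeft .P s A B _ Δ) ?_
    refine ht [(A.dual, _)] ((att_wth _ _ _).2 (.inl ⟨_, rfl, ?_⟩))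
    rw [dual_dual]; exact hA.realizes hu
  · rw [dual_dual] at hu
    refine Win.of_basicMove (.plusRight .P s A B _ Δ) ?_
    refine ht [(B.dual, _)] ((att_wth _ _ _).2 (.inr ⟨_, rfl, ?_⟩))
    rw [dual_dual]; exact hB.realizes hu

theorem Copycat.quest {A : Formula} (hA : Copycat A) : Copycat (quest A) := by
  intro a b ha hb
  obtain ⟨⟨s, Δ⟩, rfl, ht⟩ := (att_quest _ a).1 ha
  obtain ⟨u, rfl, hu⟩ := (att_bang _ b).1 hb
  rw [dual_dual] at hu
  refine Win.of_basicMove (.dereliction .P s A _ Δ) ?_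
  refine ht [(A.dual, _)] ((att_bang _ _).2 ⟨_, rfl, ?_⟩)
  rw [dual_dual]; exact hA.realizes hu

theorem copycat (A : Formula) : Copycat A := by
  induction A with
  | zero => exact .zero
  | one => exact .one
  | tens A B hA hB => exact hA.tens hB
  | plus A B hA hB => exact hA.plus hB
  | quest A hA => exact hA.quest
  | top => exact Copycat.zero.dual
  | bot => exact Copycat.one.dual
  | par A B hA hB => simpa [dual] using (hA.dual.tens hB.dual).dual
  | wth A B hA hB => simpa [dual] using (hA.dual.plus hB.dual).dual
  | bang A hA => simpa [dual] using hA.dual.quest.dual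

/-! ### Semantics of sequents -/

/-- The attachments that may replace the formulae of a sequent. -/
inductive Atts : List Formula → List (Formula × Pos) → Prop
  | nil : Atts [] []
  | cons {A : Formula} {Γ : List Formula} {a l : List (Formula × Pos)} :
      Att Win A a → Atts Γ l → Atts (A :: Γ) (a ++ l)

theorem Atts.append {Γ Δ : List Formula} {k l : List (Formula × Pos)} (h : Atts Γ k)
    (h' : Atts Δ l) : Atts (Γ ++ Δ) (k ++ l) := by
  induction h with
  | nil => exact h'
  | cons ha _ ih => rw [List.append_assoc]; exact .cons ha ih

theorem Atts.of_append {Γ Δ : List Formula} {l : List (Formula × Pos)} (h : Atts (Γ ++ Δ) l) :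
    ∃ a b, l = a ++ b ∧ Atts Γ a ∧ Atts Δ b := by
  induction Γ generalizing l with
  | nil => exact ⟨[], l, rfl, .nil, h⟩
  | cons A Γ ih =>
    obtain _ | ⟨ha, h⟩ := h
    obtain ⟨b, c, rfl, hb, hc⟩ := ih h
    exact ⟨_, c, (List.append_assoc _ _ _).symm, .cons ha hb, hc⟩

theorem Atts.of_perm {Γ Δ : List Formula} (h : Γ.Perm Δ) :
    ∀ {l : List (Formula × Pos)}, Atts Γ l → ∃ l', l.Perm l' ∧ Atts Δ l' := by
  induction h with
  | nil => exact fun h => ⟨_, .refl _, h⟩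
  | cons A _ ih =>
    rintro _ (_ | ⟨ha, h⟩)
    obtain ⟨l', hl, h'⟩ := ih h
    exact ⟨_, hl.append_left _, .cons ha h'⟩
  | swap A B Γ =>
    rintro _ (_ | ⟨ha, _ | ⟨hb, h⟩⟩)
    refine ⟨_, ?_, .cons hb (.cons ha h)⟩
    rw [← List.append_assoc, ← List.append_assoc]
    exact List.perm_append_comm.append_right _
  | trans _ _ h₁ h₂ =>
    intro l h
    obtain ⟨l', hl, h'⟩ := h₁ h
    obtain ⟨l'', hl', h''⟩ := h₂ h'
    exact ⟨l'', hl.trans hl', h''⟩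

theorem Atts.forall_quest {Θ : List Formula} : ∀ {l : List (Formula × Pos)},
    Atts (Θ.map quest) l → ∀ x ∈ l, ∃ C, x.1 = quest C := by
  induction Θ with
  | nil => rintro _ ⟨⟩; simp
  | cons C Θ ih =>
    rintro _ (_ | ⟨hc, hl⟩)
    obtain ⟨u, rfl, -⟩ := (att_quest _ _).1 hc
    simpa using ih hl

/-- Internal edges of a proponent, one for each cut formula, leading to proponents that do nothing
but pass the token. -/
def cuts (K : List Formula) : List (Formula × Pos) :=
  K.map fun A => (quest (tens A A.dual), .node .P [])

theorem cuts_append (K L : List Formula) : cuts (K ++ L) = cuts K ++ cuts L := List.map_append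

theorem cuts_cons (A : Formula) (K : List Formula) :
    cuts (A :: K) = (quest (tens A A.dual), .node .P []) :: cuts K := rfl

/-- Cut edges carry a `?`, so superfluous ones can be erased. The `&` rule needs this, since only
one premise's cuts are used. -/
theorem Win.append_cuts {Γ : List (Formula × Pos)} (h : Win (.node .P Γ)) (K : List Formula) :
    Win (.node .P (Γ ++ cuts K)) := by
  induction K with
  | nil => simpa [cuts] using h
  | cons A K ih =>
    exact Win.of_perm List.perm_middle.symm (Win.of_basicMove (.weakening _ _ _ _) ih)

/-- A proponent with suitable internal edges wins against any attachments for the sequent. -/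
def Sem (Γ : List Formula) : Prop :=
  ∃ K, ∀ l, Atts Γ l → Win (.node .P (l ++ cuts K))

theorem perm_of_coe {α : Type*} {k l : List α} (h : (k : Multiset α) = l) : k.Perm l :=
  Multiset.coe_eq_coe.1 h

/-! ### Soundness of the rules. -/

theorem Sem.ax (A : Formula) : Sem [A, A.dual] := by
  refine ⟨[], ?_⟩
  rintro _ (_ | ⟨ha, _ | ⟨hb, ⟨⟩⟩⟩)
  simpa [cuts] using copycat A _ _ ha hb

theorem Sem.exchange {Γ Δ : List Formula} (h : Γ.Perm Δ) : Sem Γ → Sem Δ := by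
  rintro ⟨K, hK⟩
  refine ⟨K, fun l hl => ?_⟩
  obtain ⟨l', hl', h'⟩ := hl.of_perm h.symm
  exact (hK l' h').of_perm (hl'.symm.append_right _)

theorem Sem.one : Sem [one] := by
  refine ⟨[], ?_⟩
  rintro _ (_ | ⟨ha, ⟨⟩⟩)
  simpa [cuts] using Copycat.one _ [] ha rfl

theorem Sem.bot {Γ : List Formula} : Sem Γ → Sem (bot :: Γ) := by
  rintro ⟨K, hK⟩
  refine ⟨K, ?_⟩
  rintro _ (_ | ⟨rfl, h⟩)
  exact hK _ h

theorem Sem.top (Γ : List Formula) : Sem (top :: Γ) := by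
  refine ⟨[], ?_⟩
  rintro _ (_ | ⟨ha, h⟩)
  exact ha.elim

theorem Sem.tens {A B : Formula} {Γ Δ Θ : List Formula} :
    Sem (A :: (Γ ++ Θ.map quest)) → Sem (B :: (Δ ++ Θ.map quest)) →
    Sem (tens A B :: (Γ ++ Δ ++ Θ.map quest)) := by
  rintro ⟨K, hK⟩ ⟨L, hL⟩
  refine ⟨K ++ L, ?_⟩
  rintro _ (_ | ⟨ha, h⟩)
  obtain ⟨⟨s, E⟩, rfl, ht⟩ := (att_tens _ _ _).1 ha
  obtain ⟨_, θ, rfl, h, hθ⟩ := h.of_append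
  obtain ⟨g, d, rfl, hg, hd⟩ := h.of_append
  refine Win.of_perm (Γ := (Formula.tens A B, .node s E) ::
    ((g ++ cuts K) ++ θ ++ (d ++ cuts L))) (perm_of_coe ?_)
    (Win.of_basicMove (.tens .P s A B _ θ _ E hθ.forall_quest) ?_)
  · simp only [cuts_append, ← Multiset.coe_add, ← Multiset.cons_coe, ← Multiset.singleton_add,
      List.singleton_append]
    abel
  refine ht [(A.dual, _), (B.dual, _)] ((att_par _ _ _).2 ⟨_, _, rfl, ?_, ?_⟩)
  · rw [dual_dual]
    intro a ha
    refine (hK _ (.cons ha (hg.append hθ))).of_perm (perm_of_coe ?_)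
    simp only [← Multiset.coe_add]
    abel
  · rw [dual_dual]
    intro a ha
    refine (hL _ (.cons ha (hd.append hθ))).of_perm (perm_of_coe ?_)
    simp only [← Multiset.coe_add]
    abel

theorem Sem.par {A B : Formula} {Γ : List Formula} :
    Sem (A :: B :: Γ) → Sem (par A B :: Γ) := by
  rintro ⟨K, hK⟩
  refine ⟨K, ?_⟩
  rintro _ (_ | ⟨ha, h⟩)
  obtain ⟨u, v, rfl, hu, hv⟩ := (att_par _ _ _).1 ha
  refine Win.cons_of_realizes ?_ hu
  intro a ha
  refine Win.of_perm List.perm_middle.symm (Win.cons_of_realizes ?_ hv)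
  intro b hb
  refine (hK _ (.cons ha (.cons hb h))).of_perm (perm_of_coe ?_)
  simp only [List.append_eq, List.nil_append, ← Multiset.coe_add]
  abel

theorem Sem.plusLeft {A B : Formula} {Γ : List Formula} :
    Sem (A :: Γ) → Sem (plus A B :: Γ) := by
  rintro ⟨K, hK⟩
  refine ⟨K, ?_⟩
  rintro _ (_ | ⟨ha, h⟩)
  obtain ⟨⟨s, Δ⟩, rfl, ht⟩ := (att_plus _ _ _).1 ha
  refine Win.of_basicMove (.plusLeft .P s A B _ Δ) ?_
  refine ht [(A.dual, _)] ((att_wth _ _ _).2 (.inl ⟨_, rfl, ?_⟩))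
  rw [dual_dual]
  intro a ha
  simpa using hK _ (.cons ha h)

theorem Sem.plusRight {A B : Formula} {Γ : List Formula} :
    Sem (B :: Γ) → Sem (plus A B :: Γ) := by
  rintro ⟨K, hK⟩
  refine ⟨K, ?_⟩
  rintro _ (_ | ⟨ha, h⟩)
  obtain ⟨⟨s, Δ⟩, rfl, ht⟩ := (att_plus _ _ _).1 ha
  refine Win.of_basicMove (.plusRight .P s A B _ Δ) ?_
  refine ht [(B.dual, _)] ((att_wth _ _ _).2 (.inr ⟨_, rfl, ?_⟩))
  rw [dual_dual]
  intro a ha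
  simpa using hK _ (.cons ha h)

theorem Sem.dereliction {A : Formula} {Γ : List Formula} :
    Sem (A :: Γ) → Sem (quest A :: Γ) := by
  rintro ⟨K, hK⟩
  refine ⟨K, ?_⟩
  rintro _ (_ | ⟨ha, h⟩)
  obtain ⟨⟨s, Δ⟩, rfl, ht⟩ := (att_quest _ _).1 ha
  refine Win.of_basicMove (.dereliction .P s A _ Δ) ?_
  refine ht [(A.dual, _)] ((att_bang _ _).2 ⟨_, rfl, ?_⟩)
  rw [dual_dual]
  intro a ha
  simpa using hK _ (.cons ha h)

theorem Sem.weakening (A : Formula) {Γ : List Formula} : Sem Γ → Sem (quest A :: Γ) := by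
  rintro ⟨K, hK⟩
  refine ⟨K, ?_⟩
  rintro _ (_ | ⟨ha, h⟩)
  obtain ⟨t, rfl, ht⟩ := (att_quest _ _).1 ha
  exact Win.of_basicMove (.weakening _ _ _ _) (hK _ h)

theorem Sem.wth {A B : Formula} {Γ : List Formula} :
    Sem (A :: Γ) → Sem (B :: Γ) → Sem (wth A B :: Γ) := by
  rintro ⟨K, hK⟩ ⟨L, hL⟩
  refine ⟨K ++ L, ?_⟩
  rintro _ (_ | ⟨ha, h⟩)
  obtain ⟨u, rfl, hu⟩ | ⟨u, rfl, hu⟩ := (att_wth _ _ _).1 ha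
  · refine Win.cons_of_realizes (fun a ha => ?_) hu
    simpa [cuts_append] using (hK _ (.cons ha h)).append_cuts L
  · refine Win.cons_of_realizes (fun a ha => ?_) hu
    refine ((hL _ (.cons ha h)).append_cuts K).of_perm (perm_of_coe ?_)
    simp only [List.append_eq, List.nil_append, cuts_append, ← Multiset.coe_add]
    abel

/-- An attachment for `!A` is a single edge `A`, so promotion is sound in an arbitrary context. -/
theorem Sem.bang {A : Formula} {Γ : List Formula} : Sem (A :: Γ) → Sem (bang A :: Γ) := by
  rintro ⟨K, hK⟩
  refine ⟨K, ?_⟩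
  rintro _ (_ | ⟨ha, h⟩)
  obtain ⟨u, rfl, hu⟩ := (att_bang _ _).1 ha
  refine Win.cons_of_realizes (fun a ha => ?_) hu
  simpa using hK _ (.cons ha h)

theorem Sem.cut {A : Formula} {Γ Δ : List Formula} :
    Sem (A :: Γ) → Sem (A.dual :: Δ) → Sem (Γ ++ Δ) := by
  rintro ⟨K, hK⟩ ⟨L, hL⟩
  refine ⟨A :: (K ++ L), ?_⟩
  intro l h
  obtain ⟨g, d, rfl, hg, hd⟩ := h.of_append
  refine Win.of_perm (Γ := (Formula.quest (Formula.tens A A.dual), .node .P []) ::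
    ((g ++ cuts K) ++ [] ++ (d ++ cuts L))) (perm_of_coe ?_)
    (Win.of_basicMove (.dereliction .P .P _ _ []) ?_)
  · simp only [cuts_cons, cuts_append, ← Multiset.coe_add, ← Multiset.cons_coe, ← Multiset.singleton_add,
      List.append_nil]
    abel
  -- Dereliction gave the token to the leaf, which returns it; the main vertex then splits along the
  -- two premises, and the leaf plays copycat between the halves.
  refine Win.of_basicMove (.neg .P .P _ [] _ trivial) ?_
  refine Win.of_basicMove (.tens .P .P A A.dual _ [] _ [] (by simp)) ?_
  refine Win.cons_of_realizes ?_ ?_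
  · rw [dual_dual]
    have h := (copycat A.dual).realizes (u := .node .P (d ++ cuts L)) fun a ha => by
      simpa using hL _ (.cons ha hd)
    rwa [dual_dual, ← List.append_nil (d ++ cuts L)] at h
  · rw [dual_dual]
    intro a ha
    simpa using hK _ (.cons ha hg)

/-- Cut of `?A ⅋ ?A` against `!A⊥ ⊗ !A⊥`, which is obtained from two identities sharing the context
`?A`. -/
theorem Sem.contraction {A : Formula} {Γ : List Formula} (h : Sem (quest A :: quest A :: Γ)) :
    Sem (quest A :: Γ) := by
  have hx : Sem (Formula.bang A.dual :: ([] ++ [A].map Formula.quest)) :=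
    (Sem.ax (quest A)).exchange (.swap _ _ _)
  exact (h.par.cut (hx.tens hx)).exchange List.perm_append_comm

theorem Provable.sem {Γ : List Formula} (h : Provable Γ) : Sem Γ := by
  induction h with
  | ax A => exact .ax A
  | cut A Γ Δ _ _ h₁ h₂ => exact h₁.cut h₂
  | exchange Γ Δ h _ ih => exact ih.exchange h
  | one => exact .one
  | bot Γ _ ih => exact ih.bot
  | top Γ => exact .top Γ
  | tens A B Γ Δ Θ _ _ h₁ h₂ => exact h₁.tens h₂
  | par A B Γ _ ih => exact ih.par
  | plusLeft A B Γ _ ih => exact ih.plusLeft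
  | plusRight A B Γ _ ih => exact ih.plusRight
  | wth A B Γ _ _ h₁ h₂ => exact h₁.wth h₂
  | dereliction A Γ _ ih => exact ih.dereliction
  | weakening A Γ _ ih => exact ih.weakening A
  | contraction A Γ _ ih => exact ih.contraction
  | promotion A Γ _ ih => exact ih.bang

/-! ### From realizers to validity -/

/-- A position is the proponents' tree with internal edges `cuts K`. -/
def IsHub (K : List Formula) (t : Pos) : Prop :=
  ∃ Γ, t = .node .P Γ ∧ Γ.Perm (cuts K)

/-- Trees whose vertices are opponents, except for proponents' trees with internal edges `cuts K`
that hang from edges labelled `A`. -/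
inductive Opp (A : Formula) (K : List Formula) : Pos → Prop
  | node (Γ : List (Formula × Pos)) :
      (∀ x ∈ Γ, ¬ (x.1 = A.dual ∧ IsHub K x.2) → Opp A K x.2) → Opp A K (node .O Γ)

/-- Disjunctive form of the constructor, whose implication keeps the inductive predicate from being
nested through `Or`. -/
theorem Opp.of_forall {A : Formula} {K : List Formula} {Γ : List (Formula × Pos)}
    (h : ∀ x ∈ Γ, Opp A K x.2 ∨ (x.1 = A.dual ∧ IsHub K x.2)) : Opp A K (.node .O Γ) :=
  .node Γ fun x hx => (h x hx).resolve_right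

theorem Opp.exists_forall {A : Formula} {K : List Formula} {t : Pos} (h : Opp A K t) :
    ∃ Γ, t = .node .O Γ ∧ ∀ x ∈ Γ, Opp A K x.2 ∨ (x.1 = A.dual ∧ IsHub K x.2) := by
  obtain ⟨Γ, h⟩ := h
  exact ⟨Γ, rfl, fun x hx => or_iff_not_imp_right.2 (h x hx)⟩

theorem Pos.Iso.eq_leaf {s : Sign} {t : Pos} (h : Iso (.node s []) t) : t = .node s [] := by
  generalize hu : Pos.node s [] = u at h
  induction h with
  | refl => rfl
  | trans _ _ h₁ h₂ => obtain rfl := h₁ hu; exact h₂ hu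
  | perm s h => cases hu; rw [List.nil_perm.1 h]
  | congr => cases hu

theorem eq_leaf_of_mem_cuts {K : List Formula} {x : Formula × Pos} (h : x ∈ cuts K) :
    x.2 = .node .P [] := by
  obtain ⟨_, -, rfl⟩ := List.mem_map.1 h
  rfl

theorem IsHub.of_iso {K : List Formula} {t u : Pos} (h : Iso t u) (ht : IsHub K t) :
    IsHub K u := by
  induction h with
  | refl => exact ht
  | trans _ _ h₁ h₂ => exact h₂ (h₁ ht)
  | perm s h =>
    obtain ⟨_, ⟨⟩, hΓ⟩ := ht
    exact ⟨_, rfl, h.symm.trans hΓ⟩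
  | congr s A Γ h =>
    obtain ⟨_, ⟨⟩, hΓ⟩ := ht
    obtain rfl := eq_leaf_of_mem_cuts (hΓ.mem_iff.1 List.mem_cons_self)
    obtain rfl := h.eq_leaf
    exact ⟨_, rfl, hΓ⟩

theorem Opp.of_iso {A : Formula} {K : List Formula} {t u : Pos} (h : Iso t u) (ht : Opp A K t) :
    Opp A K u := by
  induction h with
  | refl => exact ht
  | trans _ _ h₁ h₂ => exact h₂ (h₁ ht)
  | perm s h =>
    obtain ⟨_, ⟨⟩, hΓ⟩ := ht.exists_forall
    exact .of_forall fun x hx => hΓ x (h.mem_iff.2 hx)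
  | congr s B Γ h ih =>
    obtain ⟨_, ⟨⟩, hΓ⟩ := ht.exists_forall
    rw [List.forall_mem_cons] at hΓ
    refine .of_forall (List.forall_mem_cons.2 ⟨?_, hΓ.2⟩)
    exact hΓ.1.imp ih fun h' => ⟨h'.1, h'.2.of_iso h⟩

theorem Opp.of_allSign {A : Formula} {K : List Formula} {t : Pos} (h : t.AllSign .O) :
    Opp A K t := by
  induction h with
  | node Γ _ ih => exact .of_forall fun x hx => .inl (ih x hx)

theorem realizes_of_forall_realizes_opponent (A : Formula) {Γ : List (Formula × Pos)}
    (hΓ : ∀ x ∈ Γ, Realizes Win x.1.dual x.2) : Realizes Win A (.node .O Γ) :=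
  realizes_of_forall_realizes (fun _ _ => Win.of_iso) Win.opponent A hΓ

theorem IsHub.realizes {A : Formula} {K : List Formula}
    (hK : Realizes Win A (.node .P (cuts K))) {t : Pos} (h : IsHub K t) : Realizes Win A t := by
  obtain ⟨Γ, rfl, hΓ⟩ := h
  exact hK.of_iso (fun _ _ => Win.of_iso) (.perm _ hΓ.symm)

/-- Opponents realize everything as long as each proponent tree they meet realizes the formula on
its edge. -/
theorem Opp.realizes {A : Formula} {K : List Formula}
    (hK : Realizes Win A (.node .P (cuts K))) {t : Pos} (h : Opp A K t) (B : Formula) :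
    Realizes Win B t := by
  induction h generalizing B with
  | node Γ _ ih =>
    refine realizes_of_forall_realizes_opponent B fun x hx => ?_
    by_cases h : x.1 = A.dual ∧ IsHub K x.2
    · rw [h.1, dual_dual]
      exact h.2.realizes hK
    · exact ih x hx h _

/-- The positions with the token in the proponents' tree, at its main vertex. -/
def AtHub (A : Formula) (K : List Formula) (t : Pos) : Prop :=
  ∃ Γ V, t = .node .P Γ ∧ Opp A K V ∧ Γ.Perm ((A, V) :: cuts K)

theorem AtHub.of_iso {A : Formula} {K : List Formula} {t u : Pos} (h : Iso t u)
    (ht : AtHub A K t) : AtHub A K u := by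
  induction h with
  | refl => exact ht
  | trans _ _ h₁ h₂ => exact h₂ (h₁ ht)
  | perm s h =>
    obtain ⟨_, V, ⟨⟩, hV, hΓ⟩ := ht
    exact ⟨_, V, rfl, hV, h.symm.trans hΓ⟩
  | @congr s B Γ t u h =>
    obtain ⟨_, V, ⟨⟩, hV, hΓ⟩ := ht
    obtain hm | hm := List.mem_cons.1 (hΓ.mem_iff.1 List.mem_cons_self)
    · cases hm
      exact ⟨_, u, rfl, hV.of_iso h, hΓ.cons_inv.cons _⟩
    · obtain rfl := eq_leaf_of_mem_cuts hm
      obtain rfl := h.eq_leaf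
      exact ⟨_, V, rfl, hV, hΓ⟩

/-- The positions with the token in the proponents' tree, at one of its other vertices. -/
def AtLeaf (A : Formula) (K : List Formula) (t : Pos) : Prop :=
  ∃ F u, t = .node .P [(Formula.dual (quest F), u)] ∧
    AtHub A K (u.attach [(quest F, .node .P [])])

theorem AtLeaf.of_iso {A : Formula} {K : List Formula} {t u : Pos} (h : Iso t u)
    (ht : AtLeaf A K t) : AtLeaf A K u := by
  induction h with
  | refl => exact ht
  | trans _ _ h₁ h₂ => exact h₂ (h₁ ht)
  | perm s h =>
    obtain ⟨F, u, ⟨⟩, hu⟩ := ht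
    rw [← List.singleton_perm.1 h]
    exact ⟨F, u, rfl, hu⟩
  | @congr s B Γ t u h =>
    obtain ⟨F, u, ⟨⟩, hu⟩ := ht
    exact ⟨F, _, rfl, hu.of_iso (h.attach _)⟩

/-- Each of the three possible locations of the token is stable under isomorphism, and crossing an
edge leads from one to another or stays among the opponents. -/
theorem located_of_repuncture {A : Formula} {K : List Formula} {V W : Pos}
    (hV : V.AllSign .O) (h : (link (.node .P (cuts K)) A V).Repuncture W) :
    Opp A K W ∨ AtHub A K W ∨ AtLeaf A K W := by
  induction h with
  | refl => exact .inr (.inl ⟨_, V, rfl, .of_allSign hV, .refl _⟩)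
  | iso _ h ih => exact ih.imp (.of_iso h) (Or.imp (.of_iso h) (.of_iso h))
  | step s s' B Γ Δ _ ih =>
    obtain h | ⟨_, V, ⟨⟩, hV, hp⟩ | ⟨F, u, ht, hu⟩ := ih
    · obtain ⟨_, ⟨⟩, h⟩ := h.exists_forall
      rw [List.forall_mem_cons] at h
      obtain ⟨h' | ⟨hB, _, ⟨⟩, hp⟩, hΓ⟩ := h
      · obtain ⟨_, ⟨⟩, h'⟩ := h'.exists_forall
        exact .inl (.of_forall (List.forall_mem_cons.2 ⟨.inl (.of_forall hΓ), h'⟩))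
      · dsimp only at hB
        subst hB
        rw [dual_dual]
        exact .inr (.inl ⟨_, _, rfl, .of_forall hΓ, hp.cons _⟩)
    · obtain hm | hm := List.mem_cons.1 (hp.mem_iff.1 List.mem_cons_self)
      · cases hm
        obtain ⟨_, ⟨⟩, h⟩ := hV.exists_forall
        exact .inl (.of_forall (List.forall_mem_cons.2 ⟨.inr ⟨rfl, _, rfl, hp.cons_inv⟩, h⟩))
      · obtain ⟨F, -, hF⟩ := List.mem_map.1 hm
        cases hF
        exact .inr (.inr ⟨_, _, rfl, _, V, rfl, hV, hp⟩)
    · cases ht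
      rw [dual_dual]
      exact .inr (.inl hu)

theorem Provable.valid {A : Formula} (h : Provable [A]) : Valid A := by
  obtain ⟨K, hK⟩ := h.sem
  replace hK : Realizes Win A (.node .P (cuts K)) := fun a ha => by
    simpa [attach] using hK _ (.cons ha .nil)
  refine ⟨.node .P (cuts K), .node _ fun x hx => ?_, fun V hV W hW => ?_⟩
  · rw [eq_leaf_of_mem_cuts hx]
    exact .node _ (by simp)
  have hub : ∀ t, AtHub A K t → Win t := by
    rintro _ ⟨Γ, V, rfl, hV, hp⟩
    exact (Win.cons_of_realizes hK (hV.realizes hK _)).of_perm hp.symm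
  refine Win.exists_isWinning ?_
  obtain h | h | ⟨F, ⟨s, Γ⟩, rfl, hu⟩ := located_of_repuncture hV hW
  · have := h.realizes hK .bot [] rfl
    cases h
    exact this
  · exact hub _ h
  -- A leaf sees its cut edge as an input, so it can hand the token to the main vertex.
  · exact Win.of_basicMove (.neg .P s (quest F) [] Γ trivial) (hub _ hu)

end LLGame

theorem mainTheorem12 :
    -- all plays are finite
    (¬ ∃ p : ℕ → LLGame.Pos, ∀ n, LLGame.Pos.Move (p n) (p (n + 1))) ∧
    -- validity is consistent
    (∀ A : LLGame.Formula, ¬ (LLGame.Valid A ∧ LLGame.Valid A.dual)) ∧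
    -- validity is a model of provability
    (∀ A : LLGame.Formula, LLGame.Provable [A] → LLGame.Valid A) := by
  refine ⟨?_, fun A h => h.1.not_dual h.2, fun A h => h.valid⟩
  rintro ⟨p, hp⟩
  exact (not_acc_iff_exists_descending_chain (r := flip LLGame.Pos.Move) (x := p 0)).2 ⟨p, rfl, hp⟩
    (LLGame.acc_move _)
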